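/- **Universal projection correspondence.** *Games.* Hybrid games of differential game logic are generated by $x:=e$, $x:=\ast$, $\{x'=f(x)\,\&\,Q\}$, $?Q$, $\alpha\cup\beta$, $\alpha;\beta$, $\alpha^\ast$ (decisions and tests of Angel) and the duals $x:=\otimes$, $\{x'=f(x)\,\&\,Q\}^d$, $!Q$, $\alpha\cap\beta$, $\alpha^\times$ (decisions and tests of Demon), where $e$ and $f(x)$ are real polynomial terms and $Q$ is a formula. States assign real numbers to the variables; $\langle\alpha\rangle\phi$ holds in the states from which Angel has a winning strategy to reach $\phi$ in $\alpha$ (the usual denotational semantics, with $\alpha^\ast$ a least and $\alpha^\times$ a greatest fixed point; a player who fails her or his own test loses). In a named game $\alpha_a$ all subgame occurrences carry pairwise different labels, and $a$ is the label of the whole game. *Suffix.* For a subgame labelled $b$ of $\alpha_a$, the suffix $\alpha_{b:}$ is $\alpha$ if $b=a$; otherwise it is $(\gamma_{b:});\alpha$ if $\alpha$ is a loop $\gamma^\ast$ or $\gamma^\times$; it is $\gamma_{b:}$ or $\delta_{b:}$ (according to where $b$ lies) if $\alpha$ is $\gamma\cup\delta$ or $\gamma\cap\delta$; and if $\alpha$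 is $\gamma;\delta$ it is $(\gamma_{b:});\delta$ for $b$ in $\gamma$ and $\delta_{b:}$ for $b$ in $\delta$. *Subvalue maps.* A map $S$ from the subgame labels of $\alpha_a$ and a special label $\mathrm{end}$ to formulas is an Angelic subvalue map of $\alpha_a$ if $S(b)\to\langle\alpha_{b:}\rangle S(\mathrm{end})$ is valid for every subgame $b$. A winning condition $\phi$ is compatible with $S$ if $S(\mathrm{end})\to\phi$ is valid. $S[P]$ denotes $S$ with $S(\mathrm{end})$ replaced by $P$. *Universal projection.* $U(\alpha_a,S)$ is defined recursively: $x:=\ast$ becomes $x:=\otimes\,;\,!S(\mathrm{end})$; $\{x'=f(x)\,\&\,Q\}$ becomes $\{x'=f(x)\,\&\,Q\}^d\,;\,!S(\mathrm{end})$; $\gamma_g\cup\delta_d$ becomes $(!S(g);U(\gamma_g,S))\cap(!S(d);U(\delta_d,S))$; $(\gamma_g)^\ast$ becomes $(!S(g);U(\gamma_g,S[S(a)]))^\times;!S(\mathrm{end})$; $\gamma_g;\delta_d$ becomes $U(\gamma_g,S[S(d)]);U(\delta_d,S)$; $\gamma_g\cap\delta_d$ becomes $U(\gamma_g,S)\cap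 U(\delta_d,S)$; $(\gamma_g)^\times$ becomes $U(\gamma_g,S[S(a)])^\times$; all other atomic games are unchanged. *Strategies following $S$.* A strategy is a tree of plays (finite action sequences) in which all of Demon's actions are kept and Angel takes exactly one action at each of her decisions. It follows the policy of $S$ if each action of Angel is allowed: at $\gamma_g\cup\delta_d$ she may go left (right) only if the current state satisfies $S(g)$ (resp. $S(d)$); at $(\gamma_g)^\ast$ she may start a round only if it satisfies $S(g)$ and stop only if it satisfies $S$ at the successor (the subgame to be played next, or $\mathrm{end}$); at $x:=\ast$ the resulting state must satisfy $S$ at the successor; at $\{x'=f(x)\,\&\,Q\}$ with label $b$ she may choose a duration only if the solution satisfies $S(b)$ and $Q$ throughout and $S$ at the successor finally. A strategy for a loop of Angel is obtained by finitely many rounds of unrolling, after which no branch asks for a further round; one for a loop of Demon answers every round that Demon starts. $\Sigma(\alpha_a,S,\sigma)$ is the set of these strategies from state $\sigma$. A strategy is winning for Angel from $\sigma$ with winning condition $\phi$ if each of its maximal finite plays ends in a state satisfying $\phi$ or is undefined because of an action (failed test or evolution) of Demon. *Claim.* Let $S$ be an Angelic subvalue map of the named game $\alpha_a$, let $\phi$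 be a winning condition compatible with $S$, and let $\sigma$ be a state with $\sigma\models\langle\alpha\rangle\phi$. Then $$\sigma\models\langle U(\alpha_a,S)\rangle\phi\iff\text{every strategy in }\Sigma(\alpha_a,S,\sigma)\text{ is a winning strategy for Angel from }\sigma\text{ with winning condition }\phi .$$ -/

import Mathlib

universe u v

namespace DGL

/-! ## States, terms, differential equations -/

/-- A state assigns a real value to every variable. -/
abbrev State (V : Type u) : Type u := V → ℝ

/-- Terms are real polynomials in the variables. -/
abbrev Term (V : Type u) : Type u := MvPolynomial V ℝ

/-- The value of a term in a state. -/
noncomputable def Term.val {V : Type u} (e : Term V) (σ : State V) : ℝ := MvPolynomial.eval σ e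

/-- A (vectorial) differential equation `x' = f(x)`: the variables in `vars` evolve, `x` with
right-hand side `rhs x`; all the other variables stay constant. -/
structure ODE (V : Type u) where
  vars : Finset V
  rhs : V → Term V

/-- `D.IsSolution Q t σ φ`: `φ` solves `D` on the time interval `[0, t]` (where `0 ≤ t`), starts
in `σ`, and stays in the evolution domain `Q`. -/
def ODE.IsSolution {V : Type u} (D : ODE V) (Q : Set (State V)) (t : ℝ) (σ : State V)
    (φ : ℝ → State V) : Prop :=
  0 ≤ t ∧ φ 0 = σ ∧
    ∀ s ∈ Set.Icc (0 : ℝ) t,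
      φ s ∈ Q ∧
      (∀ x ∈ D.vars,
        HasDerivWithinAt (fun r => φ r x) ((D.rhs x).val (φ s)) (Set.Icc (0 : ℝ) t) s) ∧
      (∀ x, x ∉ D.vars → φ s x = σ x)

/-! ## Syntax of differential game logic -/

mutual

/-- Formulas. A predicate symbol is given together with its (fixed) interpretation
`p ⊆ ℝᵏ`. -/
inductive Formula (V : Type u) : Type u
  | pred (k : ℕ) (p : Set (Fin k → ℝ)) (θ : Fin k → Term V) : Formula V
  | eq (θ η : Term V) : Formula V
  | le (θ η : Term V) : Formula V
  | lt (θ η : Term V) : Formula V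
  | not (P : Formula V) : Formula V
  | and (P Q : Formula V) : Formula V
  | ex (x : V) (P : Formula V) : Formula V
  | diamond (α : Game V) (P : Formula V) : Formula V

/-- Hybrid games (without labels). -/
inductive Game (V : Type u) : Type u
  /-- `x := e` -/
  | assign (x : V) (e : Term V) : Game V
  /-- `x := *`, Angel picks the value -/
  | angelAssign (x : V) : Game V
  /-- `x := ⊗`, Demon picks the value -/
  | demonAssign (x : V) : Game V
  /-- `{x' = f(x) & Q}`, Angel picks the duration -/
  | angelODE (D : ODE V) (Q : Formula V) : Game V
  /-- `{x' = f(x) & Q}ᵈ`, Demon picks the duration -/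
  | demonODE (D : ODE V) (Q : Formula V) : Game V
  /-- `?Q`, Angel loses unless `Q` holds -/
  | angelTest (Q : Formula V) : Game V
  /-- `!Q`, Demon loses unless `Q` holds -/
  | demonTest (Q : Formula V) : Game V
  /-- `α ∪ β`, Angel chooses -/
  | angelChoice (α β : Game V) : Game V
  /-- `α ∩ β`, Demon chooses -/
  | demonChoice (α β : Game V) : Game V
  /-- `α ; β` -/
  | seq (α β : Game V) : Game V
  /-- `α*`, Angel decides before each round whether to go on -/
  | angelLoop (α : Game V) : Game V
  /-- `α^×`, Demon decides before each round whether to go on -/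
  | demonLoop (α : Game V) : Game V

end

/-! ## Denotational semantics -/

mutual

/-- The set of states in which a formula is true. -/
noncomputable def Formula.sem {V : Type u} [DecidableEq V] : Formula V → Set (State V)
  | .pred _ p θ => {σ | (fun i => (θ i).val σ) ∈ p}
  | .eq θ η => {σ | θ.val σ = η.val σ}
  | .le θ η => {σ | θ.val σ ≤ η.val σ}
  | .lt θ η => {σ | θ.val σ < η.val σ}
  | .not P => (Formula.sem P)ᶜ
  | .and P Q => Formula.sem P ∩ Formula.sem Q
  | .ex x P => {σ | ∃ r : ℝ, Function.update σ x r ∈ Formula.sem P}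
  | .diamond α P => Game.win α (Formula.sem P)

/-- `α.win X` is the winning region of Angel: the states from which Angel has a winning strategy
to reach `X` in `α`. -/
noncomputable def Game.win {V : Type u} [DecidableEq V] : Game V → Set (State V) → Set (State V)
  | .assign x e => fun X => {σ | Function.update σ x (e.val σ) ∈ X}
  | .angelAssign x => fun X => {σ | ∃ r : ℝ, Function.update σ x r ∈ X}
  | .demonAssign x => fun X => {σ | ∀ r : ℝ, Function.update σ x r ∈ X}
  | .angelODE D Q => fun X => {σ | ∃ t φ, D.IsSolution (Formula.sem Q) t σ φ ∧ φ t ∈ X}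
  | .demonODE D Q => fun X => {σ | ∀ t φ, D.IsSolution (Formula.sem Q) t σ φ → φ t ∈ X}
  | .angelTest Q => fun X => Formula.sem Q ∩ X
  | .demonTest Q => fun X => (Formula.sem Q)ᶜ ∪ X
  | .angelChoice α β => fun X => Game.win α X ∪ Game.win β X
  | .demonChoice α β => fun X => Game.win α X ∩ Game.win β X
  | .seq α β => fun X => Game.win α (Game.win β X)
  | .angelLoop α => fun X => ⋂₀ {Z | X ∪ Game.win α Z ⊆ Z}
  | .demonLoop α => fun X => ⋃₀ {Z | Z ⊆ X ∩ Game.win α Z}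

end

/-- The formula `[α]P` (Demon has a winning strategy to reach `P`). -/
def Formula.box {V : Type u} (α : Game V) (P : Formula V) : Formula V :=
  .not (.diamond α (.not P))

/-- The formula `P → Q`. -/
def Formula.imp {V : Type u} (P Q : Formula V) : Formula V := .not (.and P (.not Q))

/-- Truth of a formula in a state. -/
def Formula.Holds {V : Type u} [DecidableEq V] (σ : State V) (P : Formula V) : Prop := σ ∈ P.sem

/-- Validity of a formula: truth in all states. -/
def Formula.Valid {V : Type u} [DecidableEq V] (P : Formula V) : Prop :=
  ∀ σ : State V, Formula.Holds σ P

/-! ## Named games -/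

/-- Hybrid games in which every subgame carries a label (the first argument of each
constructor). -/
inductive NamedGame (V : Type u) (L : Type v) : Type (max u v)
  | assign (a : L) (x : V) (e : Term V) : NamedGame V L
  | angelAssign (a : L) (x : V) : NamedGame V L
  | demonAssign (a : L) (x : V) : NamedGame V L
  | angelODE (a : L) (D : ODE V) (Q : Formula V) : NamedGame V L
  | demonODE (a : L) (D : ODE V) (Q : Formula V) : NamedGame V L
  | angelTest (a : L) (Q : Formula V) : NamedGame V L
  | demonTest (a : L) (Q : Formula V) : NamedGame V L
  | angelChoice (a : L) (γ δ : NamedGame V L) : NamedGame V L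
  | demonChoice (a : L) (γ δ : NamedGame V L) : NamedGame V L
  | seq (a : L) (γ δ : NamedGame V L) : NamedGame V L
  | angelLoop (a : L) (γ : NamedGame V L) : NamedGame V L
  | demonLoop (a : L) (γ : NamedGame V L) : NamedGame V L

namespace NamedGame

/-- The label of the whole game. -/
def label {V : Type u} {L : Type v} : NamedGame V L → L
  | assign a _ _ => a
  | angelAssign a _ => a
  | demonAssign a _ => a
  | angelODE a _ _ => a
  | demonODE a _ _ => a
  | angelTest a _ => a
  | demonTest a _ => a
  | angelChoice a _ _ => a
  | demonChoice a _ _ => a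
  | seq a _ _ => a
  | angelLoop a _ => a
  | demonLoop a _ => a

/-- The labels of all the subgames (the game itself included), one entry for each occurrence. -/
def labels {V : Type u} {L : Type v} : NamedGame V L → List L
  | assign a _ _ => [a]
  | angelAssign a _ => [a]
  | demonAssign a _ => [a]
  | angelODE a _ _ => [a]
  | demonODE a _ _ => [a]
  | angelTest a _ => [a]
  | demonTest a _ => [a]
  | angelChoice a γ δ => a :: (γ.labels ++ δ.labels)
  | demonChoice a γ δ => a :: (γ.labels ++ δ.labels)
  | seq a γ δ => a :: (γ.labels ++ δ.labels)
  | angelLoop a γ => a :: γ.labels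
  | demonLoop a γ => a :: γ.labels

/-- Different subgame occurrences carry different labels. -/
def UniqueLabels {V : Type u} {L : Type v} (α : NamedGame V L) : Prop := α.labels.Nodup

/-- The underlying hybrid game. -/
def erase {V : Type u} {L : Type v} : NamedGame V L → Game V
  | assign _ x e => .assign x e
  | angelAssign _ x => .angelAssign x
  | demonAssign _ x => .demonAssign x
  | angelODE _ D Q => .angelODE D Q
  | demonODE _ D Q => .demonODE D Q
  | angelTest _ Q => .angelTest Q
  | demonTest _ Q => .demonTest Q
  | angelChoice _ γ δ => .angelChoice γ.erase δ.erase
  | demonChoice _ γ δ => .demonChoice γ.erase δ.erase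
  | seq _ γ δ => .seq γ.erase δ.erase
  | angelLoop _ γ => .angelLoop γ.erase
  | demonLoop _ γ => .demonLoop γ.erase

/-- The game suffix: what remains to be played of the game when the play is about to start an
occurrence of the subgame labelled `b`. (It matters only for `b` in `labels`.) -/
def suffix {V : Type u} {L : Type v} [DecidableEq L] (b : L) : NamedGame V L → Game V
  | angelChoice a γ δ =>
      if b = a then (angelChoice a γ δ).erase
      else if b ∈ γ.labels then γ.suffix b else δ.suffix b
  | demonChoice a γ δ =>
      if b = a then (demonChoice a γ δ).erase
      else if b ∈ γ.labels then γ.suffix b else δ.suffix b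
  | seq a γ δ =>
      if b = a then (seq a γ δ).erase
      else if b ∈ γ.labels then .seq (γ.suffix b) δ.erase else δ.suffix b
  | angelLoop a γ =>
      if b = a then (angelLoop a γ).erase else .seq (γ.suffix b) (angelLoop a γ).erase
  | demonLoop a γ =>
      if b = a then (demonLoop a γ).erase else .seq (γ.suffix b) (demonLoop a γ).erase
  | α => α.erase

/-- The successor of the subgame labelled `b`: the subgame that is played next once `b` has ended,
where `none` is the special subgame `end`. -/
def successor {V : Type u} {L : Type v} [DecidableEq L] (b : L) : NamedGame V L → Option L
  | angelChoice a γ δ =>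
      if b = a then none else if b ∈ γ.labels then γ.successor b else δ.successor b
  | demonChoice a γ δ =>
      if b = a then none else if b ∈ γ.labels then γ.successor b else δ.successor b
  | seq a γ δ =>
      if b = a then none
      else if b ∈ γ.labels then some ((γ.successor b).getD δ.label) else δ.successor b
  | angelLoop a γ => if b = a then none else some ((γ.successor b).getD a)
  | demonLoop a γ => if b = a then none else some ((γ.successor b).getD a)
  | _ => none

end NamedGame

/-! ## Subvalue maps -/

/-- Maps from subgames (given by their labels, `some b`) and the special subgame `end` (`none`) to
formulas. -/
abbrev SubgameMap (V : Type u) (L : Type v) : Type (max u v) := Option L → Formula V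

/-- `S` with the formula of `end` replaced by `P`. -/
def SubgameMap.withEnd {V : Type u} {L : Type v} (S : SubgameMap V L) (P : Formula V) :
    SubgameMap V L
  | none => P
  | some b => S (some b)

/-- `S` is an Angelic subvalue map of `α`: `S(b) → ⟨suffix of b⟩ S(end)` is valid for every subgame
`b` of `α`. -/
def IsAngelicSubvalueMap {V : Type u} {L : Type v} [DecidableEq V] [DecidableEq L]
    (α : NamedGame V L) (S : SubgameMap V L) : Prop :=
  ∀ b ∈ α.labels, ((S (some b)).imp (.diamond (α.suffix b) (S none))).Valid

/-- The winning condition `P` is compatible with `S`: `S(end) → P` is valid. -/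
def IsCompatible {V : Type u} {L : Type v} [DecidableEq V] (S : SubgameMap V L) (P : Formula V) :
    Prop :=
  ((S none).imp P).Valid

/-- The universal projection of `α` onto `S`. (Labels of the result play no role for its winning
region and are dropped.) -/
def universalProjection {V : Type u} {L : Type v} : NamedGame V L → SubgameMap V L → Game V
  | .assign _ x e, _ => .assign x e
  | .angelAssign _ x, S => .seq (.demonAssign x) (.demonTest (S none))
  | .demonAssign _ x, _ => .demonAssign x
  | .angelODE _ D Q, S => .seq (.demonODE D Q) (.demonTest (S none))
  | .demonODE _ D Q, _ => .demonODE D Q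
  | .angelTest _ Q, _ => .angelTest Q
  | .demonTest _ Q, _ => .demonTest Q
  | .angelChoice _ γ δ, S =>
      .demonChoice (.seq (.demonTest (S (some γ.label))) (universalProjection γ S))
        (.seq (.demonTest (S (some δ.label))) (universalProjection δ S))
  | .demonChoice _ γ δ, S => .demonChoice (universalProjection γ S) (universalProjection δ S)
  | .seq _ γ δ, S =>
      .seq (universalProjection γ (S.withEnd (S (some δ.label)))) (universalProjection δ S)
  | .angelLoop a γ, S =>
      .seq
        (.demonLoop (.seq (.demonTest (S (some γ.label)))
          (universalProjection γ (S.withEnd (S (some a))))))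
        (.demonTest (S none))
  | .demonLoop a γ, S => .demonLoop (universalProjection γ (S.withEnd (S (some a))))

/-! ## Actions and plays -/

/-- The actions of the players; the suffix `D` marks the actions of Demon. -/
inductive Move (V : Type u) : Type u
  | assign (x : V) (e : Term V) : Move V
  | assignD (x : V) (r : ℝ) : Move V
  | ode (D : ODE V) (Q : Formula V) (t : ℝ) : Move V
  | odeD (D : ODE V) (Q : Formula V) (t : ℝ) : Move V
  | test (Q : Formula V) : Move V
  | testD (Q : Formula V) : Move V
  | left : Move V
  | right : Move V
  | leftD : Move V
  | rightD : Move V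
  | go : Move V
  | halt : Move V
  | goD : Move V
  | haltD : Move V

/-- The result of running actions: a state, or undefined, in which case the player who was
responsible for the undefined action has lost. -/
inductive Outcome (V : Type u) : Type u
  | state (σ : State V) : Outcome V
  | angelLost : Outcome V
  | demonLost : Outcome V

open Classical in
/-- The final state of the (unique) solution of duration `t`; `lost` if there is no solution. -/
noncomputable def ODE.run {V : Type u} (D : ODE V) (Q : Set (State V)) (t : ℝ) (σ : State V)
    (lost : Outcome V) : Outcome V :=
  if h : ∃ φ, D.IsSolution Q t σ φ then .state (h.choose t) else lost

open Classical in
/-- The effect of one action. -/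
noncomputable def Move.run {V : Type u} [DecidableEq V] : Move V → State V → Outcome V
  | .assign x e, σ => .state (Function.update σ x (e.val σ))
  | .assignD x r, σ => .state (Function.update σ x r)
  | .ode D Q t, σ => D.run Q.sem t σ .angelLost
  | .odeD D Q t, σ => D.run Q.sem t σ .demonLost
  | .test Q, σ => if Formula.Holds σ Q then .state σ else .angelLost
  | .testD Q, σ => if Formula.Holds σ Q then .state σ else .demonLost
  | _, σ => .state σ

/-- Paths in game trees: finite sequences of actions. -/
abbrev Play (V : Type u) : Type u := List (Move V)

/-- The effect of a sequence of actions. -/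
noncomputable def Play.run {V : Type u} [DecidableEq V] : Play V → State V → Outcome V
  | [], σ => .state σ
  | m :: p, σ =>
      match m.run σ with
      | .state ω => Play.run p ω
      | .angelLost => .angelLost
      | .demonLost => .demonLost

/-- Trees, given as the set of the (nonempty) paths that start at the root. -/
abbrev Tree (V : Type u) : Type u := Set (Play V)

/-- The leaves of a tree: the paths that no single action extends within the tree. -/
def Tree.leaf {V : Type u} (t : Tree V) : Set (Play V) := {p | p ∈ t ∧ ∀ m, p ++ [m] ∉ t}

/-- Concatenation under prefix closure: the path `p` followed by the tree `t`. -/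
def Play.concat {V : Type u} (p : Play V) (t : Tree V) : Tree V :=
  {p} ∪ {q | ∃ w ∈ t, q = p ++ w}

/-! ## Policies and strategies -/

/-- The policy that Angel reads off from `S` in the overall game `α`: the acceptable actions at the
subgame `β` in state `σ`. (Subgames without a decision of Angel get no action.) -/
noncomputable def policy {V : Type u} {L : Type v} [DecidableEq V] [DecidableEq L]
    (α : NamedGame V L) (S : SubgameMap V L) (β : NamedGame V L) (σ : State V) : Set (Move V) :=
  match β with
  | .angelChoice _ γ δ =>
      {m | (m = .left ∧ Formula.Holds σ (S (some γ.label))) ∨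
        (m = .right ∧ Formula.Holds σ (S (some δ.label)))}
  | .angelLoop b γ =>
      {m | (m = .go ∧ Formula.Holds σ (S (some γ.label))) ∨
        (m = .halt ∧ Formula.Holds σ (S (α.successor b)))}
  | .angelAssign b x =>
      {m | ∃ e : Term V, m = .assign x e ∧
        Formula.Holds (Function.update σ x (e.val σ)) (S (α.successor b))}
  | .angelODE b D Q =>
      {m | ∃ t φ, m = .ode D Q t ∧ D.IsSolution Q.sem t σ φ ∧
        (∀ s ∈ Set.Icc (0 : ℝ) t, Formula.Holds (φ s) (S (some b))) ∧
        Formula.Holds (φ t) (S (α.successor b))}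
  | _ => ∅

/-- Sequential composition of strategies from `σ`: after every leaf `v` of `t` at which the play is
still running, continue with some strategy `u v` for the state reached. -/
def seqStrategies {V : Type u} [DecidableEq V] (first second : State V → Set (Tree V))
    (σ : State V) : Set (Tree V) :=
  {T | ∃ t ∈ first σ, ∃ u : Play V → Tree V,
    (∀ v ∈ t.leaf, ∀ ω, Play.run v σ = .state ω → u v ∈ second ω) ∧
    T = t ∪ {p | ∃ v ∈ t.leaf, (∃ ω, Play.run v σ = .state ω) ∧ p ∈ Play.concat v (u v)}}

/-- One round of unrolling of a loop, played from `σ`: every leaf of `t` of the form `u · g` (with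
`g` the action that starts a new round) is followed by a strategy `v u` of the loop body, and each
leaf of the latter at which the play is still running, by the next loop decision: the actions
`o q` after the path `q`, one of the sets that `next` offers in the state reached. -/
def unroll {V : Type u} [DecidableEq V] (g : Move V) (body : State V → Set (Tree V))
    (next : State V → Set (Set (Move V))) (σ : State V) (t t' : Tree V) : Prop :=
  ∃ (v : Play V → Tree V) (o : Play V → Set (Move V)),
    (∀ u, u ++ [g] ∈ t.leaf →
      (∃ ω, Play.run u σ = .state ω ∧ v u ∈ body ω) ∧
      ∀ w ∈ (v u).leaf, ∀ ω, Play.run (u ++ [g] ++ w) σ = .state ω →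
        o (u ++ [g] ++ w) ∈ next ω) ∧
    t' = t ∪
      {p | ∃ u, u ++ [g] ∈ t.leaf ∧
        (p ∈ Play.concat (u ++ [g]) (v u) ∨
          ∃ w ∈ (v u).leaf, (∃ ω, Play.run (u ++ [g] ++ w) σ = .state ω) ∧
            ∃ m ∈ o (u ++ [g] ++ w), p = u ++ [g] ++ w ++ [m])}

/-- Strategies for a loop of Angel: choose the first decision, unroll finitely often, with a single
policy action of Angel as each decision, until no leaf asks for a new round. -/
def angelLoopStrategies {V : Type u} [DecidableEq V] (body : State V → Set (Tree V))
    (pol : State V → Set (Move V)) (σ : State V) : Set (Tree V) :=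
  ⋃ n : ℕ, {t | t ∈ (fun Z : Set (Tree V) =>
        {t' | ∃ t ∈ Z, unroll .go body (fun ω => {o | ∃ m ∈ pol ω, o = {m}}) σ t t'})^[n]
      {t₀ | ∃ m ∈ pol σ, t₀ = {[m]}} ∧
    ¬ ∃ u, u ++ [Move.go] ∈ Tree.leaf t}

/-- Strategies for a loop of Demon: both decisions of Demon are kept at every stage, and the tree is
the union of all the stages of successive unrolling, so that every new round of Demon is answered. -/
def demonLoopStrategies {V : Type u} [DecidableEq V] (body : State V → Set (Tree V))
    (σ : State V) : Set (Tree V) :=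
  {T | ∃ t : ℕ → Tree V, t 0 = {[.haltD], [.goD]} ∧
    (∀ n, unroll .goD body (fun _ => {{.haltD, .goD}}) σ (t n) (t (n + 1))) ∧
    T = ⋃ n, t n}

/-- The set of strategies with which Angel can play `α` from a state while following the policy
of `S`. -/
noncomputable def strategies {V : Type u} {L : Type v} [DecidableEq V] [DecidableEq L] :
    NamedGame V L → SubgameMap V L → State V → Set (Tree V)
  | .assign _ x e, _ => fun _ => {{[.assign x e]}}
  | .angelAssign a x, S => fun σ =>
      {t | ∃ m ∈ policy (.angelAssign a x) S (.angelAssign a x) σ, t = {[m]}}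
  | .demonAssign _ x, _ => fun _ => {{p | ∃ r : ℝ, p = [.assignD x r]}}
  | .angelODE a D Q, S => fun σ =>
      {t | ∃ m ∈ policy (.angelODE a D Q) S (.angelODE a D Q) σ, t = {[m]}}
  | .demonODE _ D Q, _ => fun σ =>
      {{p | ∃ t φ, D.IsSolution Set.univ t σ φ ∧ p = [.odeD D Q t]}}
  | .angelTest _ Q, _ => fun _ => {{[.test Q]}}
  | .demonTest _ Q, _ => fun _ => {{[.testD Q]}}
  | .angelChoice a γ δ, S => fun σ =>
      {T | (.left ∈ policy (.angelChoice a γ δ) S (.angelChoice a γ δ) σ ∧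
          ∃ t ∈ strategies γ S σ, T = Play.concat [.left] t) ∨
        (.right ∈ policy (.angelChoice a γ δ) S (.angelChoice a γ δ) σ ∧
          ∃ t ∈ strategies δ S σ, T = Play.concat [.right] t)}
  | .demonChoice _ γ δ, S => fun σ =>
      {T | ∃ t₁ ∈ strategies γ S σ, ∃ t₂ ∈ strategies δ S σ,
        T = Play.concat [.leftD] t₁ ∪ Play.concat [.rightD] t₂}
  | .seq _ γ δ, S =>
      seqStrategies (strategies γ (S.withEnd (S (some δ.label)))) (strategies δ S)
  | .angelLoop a γ, S =>
      angelLoopStrategies (strategies γ (S.withEnd (S (some a))))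
        (policy (.angelLoop a γ) S (.angelLoop a γ))
  | .demonLoop a γ, S => demonLoopStrategies (strategies γ (S.withEnd (S (some a))))

/-- An outcome that is won by Angel: a state that satisfies `P`, or Demon has lost. -/
def Outcome.AngelWins {V : Type u} [DecidableEq V] (P : Formula V) : Outcome V → Prop
  | .state ω => Formula.Holds ω P
  | .angelLost => False
  | .demonLost => True

/-- The strategy tree `t`, played from `σ`, is winning for Angel: each of its maximal finite plays is
won by Angel. (A play without end has infinitely many rounds of a loop of Demon, who loses it.) -/
def IsWinningStrategy {V : Type u} [DecidableEq V] (P : Formula V) (σ : State V) (t : Tree V) :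
    Prop :=
  ∀ p ∈ t.leaf, (Play.run p σ).AngelWins P

end DGL

-- Under the assumptions both sides of the equivalence hold, and the winning region of the universal
-- projection links them.
--
-- `win_subset_win_universalProjection`: Angel's winning region survives projection. Demon now makes
-- Angel's decisions, but the inserted tests make him lose unless `S` allows his choice, and
-- wherever `S` allows it Angel can still win the remaining game. The proof is a structural
-- induction with a free goal region `W`: in a sequence the goal of the first part is the region
-- from which the second part is won, in the body of a loop it is the winning region of that loop,
-- and `withEnd` puts a matching formula at `end`. A loop of Angel becomes a loop of Demon, a
-- greatest fixed point, so coinduction settles it without counting rounds.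
--
-- `reaches_of_mem_win_universalProjection`: a strategy following `S` only takes actions for Angel
-- that Demon could take in the projection without failing a test. Winning the projection therefore
-- covers every branch of every such strategy. For loops this becomes an invariant on the leaves,
-- `LoopInvariant`, preserved by each `unroll`. Since an action records only the duration of an
-- evolution, uniqueness of solutions is needed to know the state reached.

namespace DGL

/-! ## Uniqueness of solutions -/

/-- The value of a polynomial term is a smooth function of finitely many of the variables. -/
theorem Term.contDiff_val {V : Type*} {E : Type*} [NormedAddCommGroup E] [NormedSpace ℝ E]
    {f : E → State V} (hf : ∀ x, ContDiff ℝ 1 fun y => f y x) (e : Term V) :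
    ContDiff ℝ 1 fun y => e.val (f y) := by
  unfold Term.val
  induction e using MvPolynomial.induction_on with
  | C r => simpa using contDiff_const
  | add p q hp hq => simpa using hp.add hq
  | mul_X p x hp => simpa using hp.mul (hf x)

/-- Polynomial right-hand sides are locally Lipschitz, so Picard–Lindelöf uniqueness applies. Only
finitely many variables evolve, which allows working in a finite-dimensional space even if `V` is
infinite; the other variables are frozen at their values in `σ`. -/
theorem ODE.IsSolution.eqOn {V : Type*} {D : ODE V} {Q Q' : Set (State V)} {t : ℝ} {σ : State V}
    {φ ψ : ℝ → State V} (hφ : D.IsSolution Q t σ φ) (hψ : D.IsSolution Q' t σ ψ) :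
    Set.EqOn φ ψ (Set.Icc 0 t) := by
  classical
  let ext : (D.vars → ℝ) → State V := fun y x => if h : x ∈ D.vars then y ⟨x, h⟩ else σ x
  let field : (D.vars → ℝ) → (D.vars → ℝ) := fun y i => (D.rhs i).val (ext y)
  have hfield : ContDiff ℝ 1 field := by
    refine contDiff_pi.2 fun i => Term.contDiff_val (fun x => ?_) _
    by_cases h : x ∈ D.vars
    · simpa [ext, h] using contDiff_apply ℝ ℝ (⟨x, h⟩ : D.vars)
    · simpa [ext, h] using contDiff_const
  have key : ∀ {R : Set (State V)} {χ : ℝ → State V}, D.IsSolution R t σ χ →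
      ∀ s ∈ Set.Icc 0 t, HasDerivWithinAt (fun r (i : D.vars) => χ r i)
        (field fun i => χ s i) (Set.Icc 0 t) s := by
    intro R χ hχ s hs
    obtain ⟨-, hd, hc⟩ := hχ.2.2 s hs
    have hext : ext (fun i => χ s i) = χ s := by
      funext x
      by_cases h : x ∈ D.vars
      · simp [ext, h]
      · simp [ext, h, hc x h]
    refine hasDerivWithinAt_pi.2 fun i => ?_
    simp only [field, hext]
    exact hd i i.2
  have cont : ∀ {R : Set (State V)} {χ : ℝ → State V}, D.IsSolution R t σ χ →
      ContinuousOn (fun r (i : D.vars) => χ r i) (Set.Icc 0 t) :=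
    fun h s hs => (key h s hs).continuousWithinAt
  have right : ∀ {R : Set (State V)} {χ : ℝ → State V}, D.IsSolution R t σ χ →
      ∀ s ∈ Set.Ico 0 t, HasDerivWithinAt (fun r (i : D.vars) => χ r i)
        (field fun i => χ s i) (Set.Ici s) s := fun h s hs =>
    (key h s (Set.Ico_subset_Icc_self hs)).mono_of_mem_nhdsWithin (Icc_mem_nhdsGE_of_mem hs)
  -- The field need not be globally Lipschitz; one constant suffices on the compact union of the two
  -- trajectories.
  obtain ⟨K, hK⟩ := hfield.locallyLipschitz.locallyLipschitzOn.exists_lipschitzOnWith_of_compact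
    ((isCompact_Icc.image_of_continuousOn (cont hφ)).union
      (isCompact_Icc.image_of_continuousOn (cont hψ)))
  have huniq := ODE_solution_unique_of_mem_Icc_right (v := fun _ => field) (fun _ _ => hK)
    (cont hφ) (right hφ)
    (fun s hs => Or.inl (Set.mem_image_of_mem _ (Set.Ico_subset_Icc_self hs)))
    (cont hψ) (right hψ)
    (fun s hs => Or.inr (Set.mem_image_of_mem _ (Set.Ico_subset_Icc_self hs)))
    (by simp [hφ.2.1, hψ.2.1])
  intro s hs
  funext x
  by_cases h : x ∈ D.vars
  · exact congrFun (huniq hs) ⟨x, h⟩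
  · rw [(hφ.2.2 s hs).2.2 x h, (hψ.2.2 s hs).2.2 x h]

/-- By uniqueness, the solution chosen inside `ODE.run` ends where any other one does. -/
theorem ODE.run_eq {V : Type*} {D : ODE V} {Q : Set (State V)} {t : ℝ} {σ : State V}
    {φ : ℝ → State V} (hφ : D.IsSolution Q t σ φ) (lost : Outcome V) :
    D.run Q t σ lost = .state (φ t) := by
  have h : ∃ φ, D.IsSolution Q t σ φ := ⟨φ, hφ⟩
  rw [ODE.run, dif_pos h, h.choose_spec.eqOn hφ (Set.right_mem_Icc.2 hφ.1)]

theorem ODE.isSolution_const {V : Type*} (D : ODE V) {Q : Set (State V)} {σ : State V}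
    (hσ : σ ∈ Q) : D.IsSolution Q 0 σ fun _ => σ := by
  refine ⟨le_rfl, rfl, fun s hs => ⟨hσ, fun x _ => ?_, fun _ _ => rfl⟩⟩
  -- On a one-point interval every number is a derivative, so the equation imposes nothing.
  obtain rfl : s = 0 := by simpa using hs
  rw [Set.Icc_self]
  exact hasDerivWithinAt_iff_hasFDerivWithinAt.2 (.of_subsingleton (by simp))

/-! ## Monotonicity of the winning regions -/

theorem Game.win_mono {V : Type*} [DecidableEq V] :
    ∀ (α : Game V) {X Y : Set (State V)}, X ⊆ Y → α.win X ⊆ α.win Y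
  | .assign x e, X, Y, h => by
      simp only [Game.win]; exact fun _ hσ => h hσ
  | .angelAssign x, X, Y, h => by
      simp only [Game.win]; exact fun _ ⟨r, hr⟩ => ⟨r, h hr⟩
  | .demonAssign x, X, Y, h => by
      simp only [Game.win]; exact fun _ hσ r => h (hσ r)
  | .angelODE D Q, X, Y, h => by
      simp only [Game.win]; exact fun _ ⟨t, φ, hs, hφ⟩ => ⟨t, φ, hs, h hφ⟩
  | .demonODE D Q, X, Y, h => by
      simp only [Game.win]; exact fun _ hσ t φ hs => h (hσ t φ hs)
  | .angelTest Q, X, Y, h => by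
      simp only [Game.win]; exact Set.inter_subset_inter_right _ h
  | .demonTest Q, X, Y, h => by
      simp only [Game.win]; exact Set.union_subset_union_right _ h
  | .angelChoice α β, X, Y, h => by
      simp only [Game.win]; exact Set.union_subset_union (win_mono α h) (win_mono β h)
  | .demonChoice α β, X, Y, h => by
      simp only [Game.win]; exact Set.inter_subset_inter (win_mono α h) (win_mono β h)
  | .seq α β, X, Y, h => by
      simp only [Game.win]; exact win_mono α (win_mono β h)
  | .angelLoop α, X, Y, h => by
      simp only [Game.win]
      exact fun _ hσ Z hZ => hσ Z ((Set.union_subset_union_left _ h).trans hZ)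
  | .demonLoop α, X, Y, h => by
      simp only [Game.win]
      exact fun _ ⟨Z, hZ, hσ⟩ => ⟨Z, Set.Subset.trans hZ (Set.inter_subset_inter_left _ h), hσ⟩

/-- By monotonicity, the union of all post-fixed points is again one. This unfolds a single round of
a loop of Demon. -/
theorem Game.win_demonLoop_subset {V : Type*} [DecidableEq V] (α : Game V) (X : Set (State V)) :
    (Game.demonLoop α).win X ⊆ X ∩ α.win ((Game.demonLoop α).win X) := by
  rintro σ hσ
  have hσ' := hσ
  rw [Game.win] at hσ'
  obtain ⟨Z, hZ, hσZ⟩ := hσ'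
  refine ⟨(hZ hσZ).1, α.win_mono ?_ (hZ hσZ).2⟩
  rw [Game.win]
  exact Set.subset_sUnion_of_mem hZ

/-- Coinduction for loops of Demon. -/
theorem Game.subset_win_demonLoop {V : Type*} [DecidableEq V] {α : Game V} {X Z : Set (State V)}
    (h : Z ⊆ X ∩ α.win Z) : Z ⊆ (Game.demonLoop α).win X := by
  rw [Game.win]
  exact Set.subset_sUnion_of_mem h

theorem Formula.sem_imp_valid {V : Type*} [DecidableEq V] {P Q : Formula V} :
    (P.imp Q).Valid ↔ P.sem ⊆ Q.sem := by
  simp only [Formula.Valid, Formula.Holds, Formula.imp, Formula.sem, Set.subset_def]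
  simp

namespace NamedGame

variable {V L : Type*}

theorem label_mem_labels (α : NamedGame V L) : α.label ∈ α.labels := by
  cases α <;> simp [label, labels]

theorem suffix_label [DecidableEq L] (α : NamedGame V L) : α.suffix α.label = α.erase := by
  cases α <;> simp [label, suffix]

end NamedGame

-- Winning the universal projection

/-- If `S(end)` lies in `W`, and `S(b)` in the region of `W` for each suffix, then every state from
which Angel can reach `W` in `α` lies in the winning region of the universal projection. -/
theorem win_subset_win_universalProjection {V L : Type*} [DecidableEq V] [DecidableEq L]
    (α : NamedGame V L) (hα : α.UniqueLabels) (S : SubgameMap V L) (W : Set (State V))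
    (hend : (S none).sem ⊆ W) (hS : ∀ b ∈ α.labels, (S (some b)).sem ⊆ (α.suffix b).win W) :
    α.erase.win W ⊆ (universalProjection α S).win W := by
  induction α generalizing S W with
  | assign | demonAssign | demonODE | angelTest | demonTest => exact subset_rfl
  | angelAssign a x =>
    intro σ _
    simp only [universalProjection, Game.win]
    -- Either Demon fails the test `!S(end)`, or the state reached lies in `W`.
    exact fun r => (em _).symm.imp_right fun h => hend h
  | angelODE a D Q =>
    intro σ _
    simp only [universalProjection, Game.win]
    exact fun t φ _ => (em _).symm.imp_right fun h => hend h
  | angelChoice a γ δ ihγ ihδ =>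
    simp only [NamedGame.UniqueLabels, NamedGame.labels, List.nodup_cons, List.mem_append,
      List.nodup_append'] at hα
    obtain ⟨ha, hγ, hδ, hd⟩ := hα
    have hSγ : ∀ b ∈ γ.labels, (S (some b)).sem ⊆ (γ.suffix b).win W := fun b hb => by
      have := hS b (by simp [NamedGame.labels, hb])
      rwa [NamedGame.suffix, if_neg (by rintro rfl; exact ha (.inl hb)), if_pos hb] at this
    have hSδ : ∀ b ∈ δ.labels, (S (some b)).sem ⊆ (δ.suffix b).win W := fun b hb => by
      have := hS b (by simp [NamedGame.labels, hb])
      rwa [NamedGame.suffix, if_neg (by rintro rfl; exact ha (.inr hb)),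
        if_neg fun h => hd h hb] at this
    have hγl := hSγ _ γ.label_mem_labels
    have hδl := hSδ _ δ.label_mem_labels
    rw [NamedGame.suffix_label] at hγl hδl
    intro σ _
    simp only [universalProjection, Game.win]
    exact ⟨(em _).symm.imp_right fun h => ihγ hγ S W hend hSγ (hγl h),
      (em _).symm.imp_right fun h => ihδ hδ S W hend hSδ (hδl h)⟩
  | demonChoice a γ δ ihγ ihδ =>
    simp only [NamedGame.UniqueLabels, NamedGame.labels, List.nodup_cons, List.mem_append,
      List.nodup_append'] at hα
    obtain ⟨ha, hγ, hδ, hd⟩ := hα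
    have hSγ : ∀ b ∈ γ.labels, (S (some b)).sem ⊆ (γ.suffix b).win W := fun b hb => by
      have := hS b (by simp [NamedGame.labels, hb])
      rwa [NamedGame.suffix, if_neg (by rintro rfl; exact ha (.inl hb)), if_pos hb] at this
    have hSδ : ∀ b ∈ δ.labels, (S (some b)).sem ⊆ (δ.suffix b).win W := fun b hb => by
      have := hS b (by simp [NamedGame.labels, hb])
      rwa [NamedGame.suffix, if_neg (by rintro rfl; exact ha (.inr hb)),
        if_neg fun h => hd h hb] at this
    simp only [NamedGame.erase, universalProjection, Game.win]
    exact Set.inter_subset_inter (ihγ hγ S W hend hSγ) (ihδ hδ S W hend hSδ)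
  | seq a γ δ ihγ ihδ =>
    simp only [NamedGame.UniqueLabels, NamedGame.labels, List.nodup_cons, List.mem_append,
      List.nodup_append'] at hα
    obtain ⟨ha, hγ, hδ, hd⟩ := hα
    have hSγ : ∀ b ∈ γ.labels, (S (some b)).sem ⊆ (γ.suffix b).win (δ.erase.win W) :=
      fun b hb => by
        have := hS b (by simp [NamedGame.labels, hb])
        rwa [NamedGame.suffix, if_neg (by rintro rfl; exact ha (.inl hb)), if_pos hb,
          Game.win] at this
    have hSδ : ∀ b ∈ δ.labels, (S (some b)).sem ⊆ (δ.suffix b).win W := fun b hb => by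
      have := hS b (by simp [NamedGame.labels, hb])
      rwa [NamedGame.suffix, if_neg (by rintro rfl; exact ha (.inr hb)),
        if_neg fun h => hd h hb] at this
    have hδl := hSδ _ δ.label_mem_labels
    rw [NamedGame.suffix_label] at hδl
    simp only [NamedGame.erase, universalProjection, Game.win]
    -- The new goal for `γ` is the region from which `δ` wins; it contains the new value at `end`,
    -- because the suffix at the label of `δ` is all of `δ`.
    exact (ihγ hγ (S.withEnd (S (some δ.label))) _ hδl hSγ).trans
      (Game.win_mono _ (ihδ hδ S W hend hSδ))
  | angelLoop a γ ih =>
    simp only [NamedGame.UniqueLabels, NamedGame.labels, List.nodup_cons] at hα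
    obtain ⟨ha, hγ⟩ := hα
    have hSγ : ∀ b ∈ γ.labels,
        (S (some b)).sem ⊆ (γ.suffix b).win ((Game.angelLoop γ.erase).win W) := fun b hb => by
      have := hS b (by simp [NamedGame.labels, hb])
      rwa [NamedGame.suffix, if_neg (by rintro rfl; exact ha hb), Game.win] at this
    have hSa : (S (some a)).sem ⊆ (Game.angelLoop γ.erase).win W := by
      simpa [NamedGame.suffix, NamedGame.erase] using hS a (by simp [NamedGame.labels])
    have hγl := hSγ _ γ.label_mem_labels
    rw [NamedGame.suffix_label] at hγl
    rw [universalProjection, NamedGame.erase, Game.win.eq_def (.seq _ _)]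
    -- The post-fixed point is the winning region of the original loop of Angel: `S(a)` lies in it,
    -- so a body ending in `S(a)` returns to it.
    refine Game.subset_win_demonLoop fun σ _ => ⟨?_, ?_⟩
    · simp only [Game.win]
      exact (em _).symm.imp_right fun h => hend h
    · rw [Game.win.eq_def (.seq _ _)]
      dsimp only
      rw [Game.win.eq_def (.demonTest _)]
      exact (em _).symm.imp_right fun h => ih hγ (S.withEnd (S (some a))) _ hSa hSγ (hγl h)
  | demonLoop a γ ih =>
    simp only [NamedGame.UniqueLabels, NamedGame.labels, List.nodup_cons] at hα
    obtain ⟨ha, hγ⟩ := hα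
    have hSγ : ∀ b ∈ γ.labels,
        (S (some b)).sem ⊆ (γ.suffix b).win ((Game.demonLoop γ.erase).win W) := fun b hb => by
      have := hS b (by simp [NamedGame.labels, hb])
      rwa [NamedGame.suffix, if_neg (by rintro rfl; exact ha hb), Game.win] at this
    have hSa : (S (some a)).sem ⊆ (Game.demonLoop γ.erase).win W := by
      simpa [NamedGame.suffix, NamedGame.erase] using hS a (by simp [NamedGame.labels])
    exact Game.subset_win_demonLoop ((Game.win_demonLoop_subset _ _).trans
      (Set.inter_subset_inter_right _ (ih hγ (S.withEnd (S (some a))) _ hSa hSγ)))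

/-! ## Plays of strategies -/

/-- An outcome that is won by Angel when her goal is to reach the region `W`. -/
def Outcome.Reaches {V : Type*} (W : Set (State V)) : Outcome V → Prop
  | .state ω => ω ∈ W
  | .angelLost => False
  | .demonLost => True

theorem Outcome.reaches_sem {V : Type*} [DecidableEq V] (P : Formula V) (o : Outcome V) :
    o.Reaches P.sem ↔ o.AngelWins P := by
  cases o <;> rfl

theorem Play.run_append {V : Type*} [DecidableEq V] {p : Play V} {σ ω : State V}
    (h : Play.run p σ = .state ω) (q : Play V) : Play.run (p ++ q) σ = Play.run q ω := by
  induction p generalizing σ with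
  | nil => simp only [Play.run, Outcome.state.injEq] at h; simp [h]
  | cons m p ih =>
    simp only [List.cons_append, Play.run] at h ⊢
    cases hm : m.run σ with
    | state τ => rw [hm] at h; exact ih h
    | angelLost => simp [hm] at h
    | demonLost => simp [hm] at h

theorem Play.run_singleton {V : Type*} [DecidableEq V] (m : Move V) (σ : State V) :
    Play.run [m] σ = m.run σ := by
  simp only [Play.run]
  cases m.run σ <;> rfl

theorem Tree.leaf_of_subset {V : Type*} {t t' : Tree V} (h : t ⊆ t') {p : Play V}
    (hp : p ∈ t'.leaf) (hpt : p ∈ t) : p ∈ t.leaf :=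
  ⟨hpt, fun m hm => hp.2 m (h hm)⟩

/-- A leaf of a tree with the subtree `p · t` on top of `p`, when `t` has a root action, is not
`p` itself, but comes from a leaf of `t`. -/
theorem Tree.exists_leaf_of_mem_concat {V : Type*} {t T : Tree V} {p q : Play V}
    (h : Play.concat p t ⊆ T) (ht : ∃ m, [m] ∈ t) (hq : q ∈ T.leaf) (hqt : q ∈ Play.concat p t) :
    ∃ w ∈ t.leaf, q = p ++ w := by
  rcases hqt with rfl | ⟨w, hw, rfl⟩
  · obtain ⟨m, hm⟩ := ht
    exact absurd (h (.inr ⟨[m], hm, rfl⟩)) (hq.2 m)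
  · exact ⟨w, ⟨hw, fun m hm => hq.2 m (h (.inr ⟨w ++ [m], hm, by simp⟩))⟩, rfl⟩

theorem unroll.subset {V : Type*} [DecidableEq V] {g : Move V} {body : State V → Set (Tree V)}
    {next : State V → Set (Set (Move V))} {σ : State V} {t t' : Tree V}
    (h : unroll g body next σ t t') : t ⊆ t' := by
  obtain ⟨v, o, -, rfl⟩ := h
  exact Set.subset_union_left

/-- A strategy without a first action would leave the node it is attached to as a leaf, and a
composed play could stop between two subgames. -/
theorem exists_root_of_mem_strategies {V L : Type*} [DecidableEq V] [DecidableEq L]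
    (α : NamedGame V L) (S : SubgameMap V L) (σ : State V) (t : Tree V)
    (ht : t ∈ strategies α S σ) : ∃ m, [m] ∈ t := by
  induction α generalizing S σ t with
  | assign | angelTest | demonTest =>
    simp only [strategies, Set.mem_singleton_iff] at ht
    subst ht
    exact ⟨_, rfl⟩
  | angelAssign | angelODE =>
    obtain ⟨m, -, rfl⟩ := ht
    exact ⟨m, rfl⟩
  | demonAssign a x =>
    simp only [strategies, Set.mem_singleton_iff] at ht
    exact ⟨.assignD x 0, ht ▸ ⟨0, rfl⟩⟩
  | demonODE a D Q =>
    simp only [strategies, Set.mem_singleton_iff] at ht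
    exact ⟨.odeD D Q 0, ht ▸ ⟨0, _, D.isSolution_const (Set.mem_univ σ), rfl⟩⟩
  | angelChoice a γ δ =>
    rcases ht with ⟨-, t, -, rfl⟩ | ⟨-, t, -, rfl⟩
    exacts [⟨_, .inl rfl⟩, ⟨_, .inl rfl⟩]
  | demonChoice a γ δ =>
    obtain ⟨t₁, -, t₂, -, rfl⟩ := ht
    exact ⟨_, .inl (.inl rfl)⟩
  | seq a γ δ ihγ =>
    obtain ⟨t, ht, u, -, rfl⟩ := ht
    obtain ⟨m, hm⟩ := ihγ _ _ _ ht
    exact ⟨m, .inl hm⟩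
  | angelLoop a γ =>
    obtain ⟨n, hn, -⟩ := Set.mem_iUnion.1 ht
    clear ht
    induction n generalizing t with
    | zero =>
      obtain ⟨m, -, rfl⟩ := hn
      exact ⟨m, rfl⟩
    | succ n ih =>
      rw [Function.iterate_succ_apply'] at hn
      obtain ⟨t₁, ht₁, hu⟩ := hn
      obtain ⟨m, hm⟩ := ih t₁ ht₁
      exact ⟨m, hu.subset hm⟩
  | demonLoop a γ =>
    obtain ⟨t, h0, -, rfl⟩ := ht
    exact ⟨.haltD, Set.mem_iUnion.2 ⟨0, by simp [h0]⟩⟩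

-- Invariants of loop strategies

/-- The loop invariant of unrolling: every leaf is lost by Demon, or asks for a new round in a state
of `A`, or has stopped in a state of `W`. -/
def LoopInvariant {V : Type*} [DecidableEq V] (g : Move V) (A W : Set (State V)) (σ : State V)
    (t : Tree V) : Prop :=
  ∀ p ∈ t.leaf, Play.run p σ = .demonLost ∨ ∃ ω, Play.run p σ = .state ω ∧
    ((∃ u, p = u ++ [g]) ∧ ω ∈ A ∨ (¬ ∃ u, p = u ++ [g]) ∧ ω ∈ W)

theorem LoopInvariant.reaches {V : Type*} [DecidableEq V] {g : Move V} {A W : Set (State V)}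
    {σ : State V} {t : Tree V} (h : LoopInvariant g A W σ t) {p : Play V} (hp : p ∈ t.leaf)
    (hg : ¬ ∃ u, p = u ++ [g]) : (Play.run p σ).Reaches W := by
  rcases h p hp with h | ⟨ω, h, h' | h'⟩
  · rw [h]; trivial
  · exact absurd h'.1 hg
  · rw [h]; exact h'.2

/-- A round leads from `A` through the body into `B`, and the next decision leads from `B` either
back to `A` (another round) or to `W` (stop). Leaves of the body that are still running receive a
decision and so are no longer leaves; those that remain are lost by Demon. -/
theorem unroll.loopInvariant {V : Type*} [DecidableEq V] {g : Move V}
    {body : State V → Set (Tree V)} {next : State V → Set (Set (Move V))} {σ : State V}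
    {t t' : Tree V} (h : unroll g body next σ t t') {A B W : Set (State V)}
    (hg : ∀ ω, g.run ω = .state ω) (hroot : ∀ ω, ∀ t ∈ body ω, ∃ m, [m] ∈ t)
    (hbody : ∀ ω ∈ A, ∀ t ∈ body ω, ∀ p ∈ t.leaf, (Play.run p ω).Reaches B)
    (hne : ∀ ω, ∀ o ∈ next ω, o.Nonempty)
    (hnext : ∀ ω ∈ B, ∀ o ∈ next ω, ∀ m ∈ o,
      m.run ω = .state ω ∧ (m = g ∧ ω ∈ A ∨ m ≠ g ∧ ω ∈ W))
    (ht : LoopInvariant g A W σ t) : LoopInvariant g A W σ t' := by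
  have hsub := h.subset
  obtain ⟨v, o, hv, rfl⟩ := h
  intro p hp
  have hstate : ∀ u, u ++ [g] ∈ t.leaf →
      ∃ ω ∈ A, Play.run (u ++ [g]) σ = .state ω ∧ v u ∈ body ω := by
    intro u hu
    obtain ⟨⟨ω, hω, hb⟩, -⟩ := hv u hu
    have hrun : Play.run (u ++ [g]) σ = .state ω := by
      rw [Play.run_append hω, Play.run_singleton, hg]
    rcases ht _ hu with h | ⟨τ, h, h' | h'⟩
    · rw [hrun] at h; cases h
    · rw [hrun] at h; cases h
      exact ⟨ω, h'.2, hrun, hb⟩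
    · exact absurd ⟨u, rfl⟩ h'.1
  rcases hp.1 with hpt | ⟨u, hu, hpu | ⟨w, hw, ⟨ω', hω'⟩, m, hm, rfl⟩⟩
  · exact ht p (Tree.leaf_of_subset hsub hp hpt)
  · obtain ⟨ω, hωA, hrun, hb⟩ := hstate u hu
    obtain ⟨w, hw, rfl⟩ := Tree.exists_leaf_of_mem_concat
      (fun q hq => Or.inr ⟨u, hu, .inl hq⟩) (hroot ω _ hb) hp hpu
    have hB := hbody ω hωA _ hb w hw
    rw [← Play.run_append hrun] at hB
    cases hr : Play.run (u ++ [g] ++ w) σ with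
    | state τ =>
      obtain ⟨m, hm⟩ := hne _ _ ((hv u hu).2 w hw τ hr)
      exact absurd (.inr ⟨u, hu, .inr ⟨w, hw, ⟨τ, hr⟩, m, hm, rfl⟩⟩) (hp.2 m)
    | angelLost => rw [hr] at hB; exact hB.elim
    | demonLost => exact .inl rfl
  · obtain ⟨ω, hωA, hrun, hb⟩ := hstate u hu
    have hB := hbody ω hωA _ hb w hw
    rw [← Play.run_append hrun, hω'] at hB
    obtain ⟨hmr, hm'⟩ := hnext ω' hB _ ((hv u hu).2 w hw ω' hω') m hm
    refine .inr ⟨ω', by rw [Play.run_append hω', Play.run_singleton, hmr], ?_⟩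
    rcases hm' with ⟨rfl, hA⟩ | ⟨hmg, hW⟩
    · exact .inl ⟨⟨_, rfl⟩, hA⟩
    · exact .inr ⟨fun ⟨u', hu'⟩ => hmg (by simpa using (List.append_inj' hu' rfl).2), hW⟩

-- Strategies that follow the subvalue map

/-- From a state in which Angel wins the universal projection, all the strategies that follow `S`
are winning. -/
theorem reaches_of_mem_win_universalProjection {V L : Type*} [DecidableEq V] [DecidableEq L]
    (α : NamedGame V L) (S : SubgameMap V L) (W : Set (State V)) (σ : State V)
    (hσ : σ ∈ (universalProjection α S).win W) (t : Tree V) (ht : t ∈ strategies α S σ)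
    (p : Play V) (hp : p ∈ t.leaf) : (Play.run p σ).Reaches W := by
  induction α generalizing S W σ t p with
  | assign a x e =>
    simp only [strategies, Set.mem_singleton_iff] at ht
    subst ht
    obtain rfl := hp.1
    simp only [universalProjection, Game.win] at hσ
    exact hσ
  | angelAssign a x =>
    obtain ⟨m, ⟨e, rfl, he⟩, rfl⟩ := ht
    obtain rfl := hp.1
    simp only [universalProjection, Game.win] at hσ
    exact (hσ _).resolve_left fun h => h he
  | demonAssign a x =>
    simp only [strategies, Set.mem_singleton_iff] at ht
    subst ht
    obtain ⟨r, rfl⟩ := hp.1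
    simp only [universalProjection, Game.win] at hσ
    exact hσ r
  | angelODE a D Q =>
    obtain ⟨m, ⟨d, χ, rfl, hs, -, hend⟩, rfl⟩ := ht
    obtain rfl := hp.1
    simp only [universalProjection, Game.win] at hσ
    rw [Play.run_singleton, Move.run, ODE.run_eq hs]
    exact (hσ _ _ hs).resolve_left fun h => h hend
  | demonODE a D Q =>
    simp only [strategies, Set.mem_singleton_iff] at ht
    subst ht
    obtain ⟨d, -, -, rfl⟩ := hp.1
    simp only [universalProjection, Game.win] at hσ
    rw [Play.run_singleton, Move.run]
    -- The tree offers Demon every duration for which a solution exists, even one leaving `Q`;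
    -- leaving `Q` is a loss for Demon.
    by_cases h : ∃ χ, D.IsSolution Q.sem d σ χ
    · obtain ⟨χ, hχ⟩ := h
      rw [ODE.run_eq hχ]
      exact hσ _ _ hχ
    · rw [ODE.run, dif_neg h]
      trivial
  | angelTest a Q =>
    simp only [strategies, Set.mem_singleton_iff] at ht
    subst ht
    obtain rfl := hp.1
    simp only [universalProjection, Game.win] at hσ
    rw [Play.run_singleton, Move.run, if_pos (show Formula.Holds σ Q from hσ.1)]
    exact hσ.2
  | demonTest a Q =>
    simp only [strategies, Set.mem_singleton_iff] at ht
    subst ht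
    obtain rfl := hp.1
    simp only [universalProjection, Game.win] at hσ
    rw [Play.run_singleton, Move.run]
    split_ifs with h
    · exact hσ.resolve_left fun h' => h' h
    · trivial
  | angelChoice a γ δ ihγ ihδ =>
    simp only [universalProjection, Game.win] at hσ
    rcases ht with ⟨hpol, t, ht, rfl⟩ | ⟨hpol, t, ht, rfl⟩
    · obtain ⟨w, hw, rfl⟩ := Tree.exists_leaf_of_mem_concat subset_rfl
        (exists_root_of_mem_strategies _ _ _ _ ht) hp hp.1
      simp only [policy, Set.mem_ofPred_eq, true_and, reduceCtorEq, false_and, or_false] at hpol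
      exact ihγ S W σ (hσ.1.resolve_left fun h => h hpol) t ht w hw
    · obtain ⟨w, hw, rfl⟩ := Tree.exists_leaf_of_mem_concat subset_rfl
        (exists_root_of_mem_strategies _ _ _ _ ht) hp hp.1
      simp only [policy, Set.mem_ofPred_eq, true_and, reduceCtorEq, false_and, false_or] at hpol
      exact ihδ S W σ (hσ.2.resolve_left fun h => h hpol) t ht w hw
  | demonChoice a γ δ ihγ ihδ =>
    simp only [universalProjection, Game.win] at hσ
    obtain ⟨t₁, ht₁, t₂, ht₂, rfl⟩ := ht
    rcases hp.1 with hpt | hpt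
    · obtain ⟨w, hw, rfl⟩ := Tree.exists_leaf_of_mem_concat Set.subset_union_left
        (exists_root_of_mem_strategies _ _ _ _ ht₁) hp hpt
      exact ihγ S W σ hσ.1 t₁ ht₁ w hw
    · obtain ⟨w, hw, rfl⟩ := Tree.exists_leaf_of_mem_concat Set.subset_union_right
        (exists_root_of_mem_strategies _ _ _ _ ht₂) hp hpt
      exact ihδ S W σ hσ.2 t₂ ht₂ w hw
  | seq a γ δ ihγ ihδ =>
    simp only [universalProjection, Game.win] at hσ
    obtain ⟨t, ht, u, hu, rfl⟩ := ht
    rcases hp.1 with hpt | ⟨v, hv, ⟨ω, hω⟩, hpv⟩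
    · have hpl := Tree.leaf_of_subset Set.subset_union_left hp hpt
      have hr := ihγ _ _ σ hσ t ht p hpl
      cases hrun : Play.run p σ with
      | state ω =>
        obtain ⟨m, hm⟩ := exists_root_of_mem_strategies _ _ _ _ (hu p hpl ω hrun)
        exact absurd (.inr ⟨p, hpl, ⟨ω, hrun⟩, .inr ⟨[m], hm, rfl⟩⟩) (hp.2 m)
      | angelLost => rw [hrun] at hr; exact hr
      | demonLost => trivial
    · have hr := ihγ _ _ σ hσ t ht v hv
      rw [hω] at hr
      obtain ⟨w, hw, rfl⟩ := Tree.exists_leaf_of_mem_concat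
        (fun q hq => Or.inr ⟨v, hv, ⟨ω, hω⟩, hq⟩)
        (exists_root_of_mem_strategies _ _ _ _ (hu v hv ω hω)) hp hpv
      rw [Play.run_append hω]
      exact ihδ S W ω hr _ (hu v hv ω hω) w hw
  | angelLoop a γ ih =>
    rw [universalProjection, Game.win.eq_def (.seq _ _)] at hσ
    dsimp only at hσ
    -- `Z` is the region from which Angel wins the projected loop, including its final test; it is
    -- the invariant at every loop decision.
    set Z := (Game.demonLoop (.seq (.demonTest (S (some γ.label)))
      (universalProjection γ (S.withEnd (S (some a)))))).win ((Game.demonTest (S none)).win W)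
    have hZend : ∀ ω ∈ Z, ω ∈ (S none).sem → ω ∈ W := fun ω hω h => by
      have := (Game.win_demonLoop_subset _ _ hω).1
      rw [Game.win] at this
      exact this.resolve_left fun h' => h' h
    have hZgo : ∀ ω ∈ Z, ω ∈ (S (some γ.label)).sem →
        ω ∈ (universalProjection γ (S.withEnd (S (some a)))).win Z := fun ω hω h => by
      have := (Game.win_demonLoop_subset _ _ hω).2
      rw [Game.win.eq_def (.seq _ _)] at this
      dsimp only at this
      rw [Game.win.eq_def (.demonTest _)] at this
      exact this.resolve_left fun h' => h' h
    have hpol : ∀ ω ∈ Z, ∀ m ∈ policy (.angelLoop a γ) S (.angelLoop a γ) ω,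
        m.run ω = .state ω ∧
          (m = .go ∧ ω ∈ Z ∩ (S (some γ.label)).sem ∨ m ≠ .go ∧ ω ∈ W) := by
      rintro ω hω m (⟨rfl, h⟩ | ⟨rfl, h⟩)
      · exact ⟨rfl, .inl ⟨rfl, hω, h⟩⟩
      · simp only [NamedGame.successor, if_true] at h
        exact ⟨rfl, .inr ⟨by simp, hZend ω hω h⟩⟩
    obtain ⟨n, hn, hgo⟩ := Set.mem_iUnion.1 ht
    -- No leaf of the finished tree ends in `go`, so the invariant leaves only stopping in `W` or a
    -- loss of Demon.
    suffices LoopInvariant .go (Z ∩ (S (some γ.label)).sem) W σ t from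
      this.reaches hp fun ⟨u, hu⟩ => hgo ⟨u, hu ▸ hp⟩
    clear hgo hp ht
    induction n generalizing t with
    | zero =>
      obtain ⟨m, hm, rfl⟩ := hn
      intro q hq
      obtain rfl := hq.1
      obtain ⟨hmr, hm'⟩ := hpol σ hσ m hm
      refine .inr ⟨σ, by rw [Play.run_singleton, hmr], ?_⟩
      rcases hm' with ⟨rfl, hA⟩ | ⟨hmg, hW⟩
      · exact .inl ⟨⟨[], rfl⟩, hA⟩
      · exact .inr ⟨fun ⟨u, hu⟩ => hmg (by simpa using (List.append_inj' (s₁ := []) hu rfl).2), hW⟩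
    | succ n ihn =>
      rw [Function.iterate_succ_apply'] at hn
      obtain ⟨t₁, ht₁, hu⟩ := hn
      refine hu.loopInvariant (B := Z) (fun _ => rfl)
        (fun ω t ht => exists_root_of_mem_strategies _ _ _ _ ht)
        (fun ω hω t ht p hp => ih _ Z ω (hZgo ω hω.1 hω.2) t ht p hp) ?_ ?_ (ihn t₁ ht₁)
      · rintro ω o ⟨m, -, rfl⟩
        exact Set.singleton_nonempty m
      · rintro ω hω o ⟨m, hm, rfl⟩ m' rfl
        exact hpol ω hω m' hm
  | demonLoop a γ ih =>
    rw [universalProjection] at hσ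
    set Z := (Game.demonLoop (universalProjection γ (S.withEnd (S (some a))))).win W
    obtain ⟨t, h0, hstep, rfl⟩ := ht
    have hmove : ∀ ω ∈ Z, ∀ m ∈ ({.haltD, .goD} : Set (Move V)),
        m.run ω = .state ω ∧ (m = .goD ∧ ω ∈ Z ∨ m ≠ .goD ∧ ω ∈ W) := by
      rintro ω hω m (rfl | rfl)
      · exact ⟨rfl, .inr ⟨by simp, (Game.win_demonLoop_subset _ _ hω).1⟩⟩
      · exact ⟨rfl, .inl ⟨rfl, hω⟩⟩
    have hinv : ∀ n, LoopInvariant .goD Z W σ (t n) := by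
      intro n
      induction n with
      | zero =>
        rw [h0]
        intro q hq
        obtain ⟨m, hm, rfl⟩ : ∃ m ∈ ({.haltD, .goD} : Set (Move V)), q = [m] := by
          rcases hq.1 with rfl | rfl
          exacts [⟨_, .inl rfl, rfl⟩, ⟨_, .inr rfl, rfl⟩]
        obtain ⟨hmr, hm'⟩ := hmove σ hσ m hm
        refine .inr ⟨σ, by rw [Play.run_singleton, hmr], ?_⟩
        rcases hm' with ⟨rfl, hA⟩ | ⟨hmg, hW⟩
        · exact .inl ⟨⟨[], rfl⟩, hA⟩
        · exact .inr
            ⟨fun ⟨u, hu⟩ => hmg (by simpa using (List.append_inj' (s₁ := []) hu rfl).2), hW⟩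
      | succ n ihn =>
        refine (hstep n).loopInvariant (B := Z) (fun _ => rfl)
          (fun ω t ht => exists_root_of_mem_strategies _ _ _ _ ht)
          (fun ω hω t ht p hp => ih _ Z ω (Game.win_demonLoop_subset _ _ hω).2 t ht p hp)
          ?_ ?_ ihn
        · rintro ω o rfl
          exact ⟨.haltD, .inl rfl⟩
        · rintro ω hω o rfl m hm
          exact hmove ω hω m hm
    obtain ⟨n, hn⟩ := Set.mem_iUnion.1 hp.1
    -- A leaf of the union is a leaf of some stage, and it cannot end in `goD`, since the next stage
    -- attaches a body strategy with a first action there.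
    refine (hinv n).reaches (Tree.leaf_of_subset (Set.subset_iUnion t n) hp hn) ?_
    rintro ⟨u, rfl⟩
    obtain ⟨v, o, hv, hsucc⟩ := hstep n
    have hu := Tree.leaf_of_subset (Set.subset_iUnion t n) hp hn
    obtain ⟨⟨ω, -, hb⟩, -⟩ := hv u hu
    obtain ⟨m, hm⟩ := exists_root_of_mem_strategies _ _ _ _ hb
    refine hp.2 m (Set.mem_iUnion.2 ⟨n + 1, ?_⟩)
    rw [hsucc]
    exact .inr ⟨u, hu, .inl (.inr ⟨[m], hm, rfl⟩)⟩

end DGL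

theorem mainTheorem9 {V : Type*} {L : Type*} [DecidableEq V] [DecidableEq L]
    (α : DGL.NamedGame V L) (hα : α.UniqueLabels)
    (S : DGL.SubgameMap V L) (hS : DGL.IsAngelicSubvalueMap α S)
    (φ : DGL.Formula V) (hφ : DGL.IsCompatible S φ)
    (σ : DGL.State V) (hσ : DGL.Formula.Holds σ (.diamond α.erase φ)) :
    DGL.Formula.Holds σ (.diamond (DGL.universalProjection α S) φ) ↔
      ∀ t ∈ DGL.strategies α S σ, DGL.IsWinningStrategy φ σ t := by
  have hend := DGL.Formula.sem_imp_valid.1 hφ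
  simp only [DGL.Formula.Holds, DGL.Formula.sem] at hσ ⊢
  refine ⟨fun h t ht p hp => (DGL.Outcome.reaches_sem φ _).1
    (DGL.reaches_of_mem_win_universalProjection α S _ σ h t ht p hp), fun _ => ?_⟩
  refine DGL.win_subset_win_universalProjection α hα S _ hend (fun b hb => ?_) hσ
  have := DGL.Formula.sem_imp_valid.1 (hS b hb)
  rw [DGL.Formula.sem.eq_def (.diamond _ _)] at this
  -- The subvalue property concerns the goal `S(end)`; compatibility and monotonicity enlarge that
  -- goal to `φ`.
  exact this.trans (DGL.Game.win_mono _ hend)
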